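/- Let $\mathbb F\in\{\mathbb R,\mathbb C\}$ and let $X$ be a Tychonoff (completely regular Hausdorff) space. Let $C(X)$ be the space of all continuous functions $f:X\to\mathbb F$, and let $\mathcal T$ be a locally convex vector topology on $C(X)$ with $\mathcal T_p\subseteq\mathcal T\subseteq\mathcal T_k$, where $\mathcal T_p$ is the topology of pointwise convergence and $\mathcal T_k$ is the compact-open topology. Write $E=C_{\mathcal T}(X)$ for $C(X)$ endowed with $\mathcal T$, and let $E'$ be its topological dual, that is, the space of continuous linear functionals $\mu:E\to\mathbb F$. A barrel in $E$ is a closed, absorbent and absolutely convex subset of $E$. A set $B\subseteq E$ is barrel-bounded if for every barrel $U\subseteq E$ there is a natural number $n$ with $B\subseteq nU$. Let $\beta^*(E',E)$ be the topology on $E'$ of uniform convergence on the barrel-bounded subsets of $E$, and let $\sigma(E',E)$ be the weak$^*$ topology on $E'$. The space $E$ has the Josefson–Nissenzweig property (JNP) if the identity map $(E',\sigma(E',E))\to(E',\beta^*(E',E))$ is not sequentially continuous. For $\mu\in E'$ put $$\|\mu\|:=\sup\{|\mu(f)| : f\in C(X),\ |f(x)|\le 1\text{ for all }x\in X\}.$$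 Then $C_{\mathcal T}(X)$ has the JNP if and only if there is a sequence $(\mu_n)_{n\in\mathbb N}$ in $C_{\mathcal T}(X)'$ that converges to $0$ in the weak$^*$ topology and satisfies $\|\mu_n\|=1$ for every $n\in\mathbb N$. -/

import Mathlib

open Filter Topology
open scoped ENNReal Pointwise

noncomputable section

/-- A barrel in a topological vector space over `𝕜 = ℝ` or `ℂ`: a closed, absorbent and
absolutely convex (that is, balanced and convex) set. -/
def IsBarrel (𝕜 : Type*) {E : Type*} [RCLike 𝕜] [AddCommGroup E] [Module 𝕜 E] [Module ℝ E]
    [TopologicalSpace E] (U : Set E) : Prop :=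
  IsClosed U ∧ Absorbent 𝕜 U ∧ Balanced 𝕜 U ∧ Convex ℝ U

/-- `B` is barrel-bounded if every barrel `U` satisfies `B ⊆ n U` for some natural number `n`. -/
def IsBarrelBounded (𝕜 : Type*) {E : Type*} [RCLike 𝕜] [AddCommGroup E] [Module 𝕜 E]
    [Module ℝ E] [TopologicalSpace E] (B : Set E) : Prop :=
  ∀ U : Set E, IsBarrel 𝕜 U → ∃ n : ℕ, B ⊆ (n : 𝕜) • U

/-- The dual `E'` with the topology `β*(E', E)` of uniform convergence on the barrel-bounded
subsets of `E`. -/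
abbrev BetaStarDual (𝕜 E : Type*) [RCLike 𝕜] [AddCommGroup E] [Module 𝕜 E] [Module ℝ E]
    [TopologicalSpace E] : Type _ :=
  UniformConvergenceCLM (RingHom.id 𝕜) 𝕜 {B : Set E | IsBarrelBounded 𝕜 B}

/-- The identity map from the weak* dual of `E` to the dual with the topology `β*(E', E)`. -/
def weakToBetaStar (𝕜 E : Type*) [RCLike 𝕜] [AddCommGroup E] [Module 𝕜 E] [Module ℝ E]
    [TopologicalSpace E] (χ : WeakDual 𝕜 E) : BetaStarDual 𝕜 E :=
  UniformConvergenceCLM.ofFun (RingHom.id 𝕜) 𝕜 {B : Set E | IsBarrelBounded 𝕜 B}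
    (WeakDual.toStrongDual χ)

/-- The Josefson-Nissenzweig property: the identity map from the weak* dual to the dual with the
topology `β*(E', E)` is not sequentially continuous. -/
def HasJNP (𝕜 E : Type*) [RCLike 𝕜] [AddCommGroup E] [Module 𝕜 E] [Module ℝ E]
    [TopologicalSpace E] : Prop :=
  ¬ SeqContinuous (weakToBetaStar 𝕜 E)

/-- The seminorm `‖χ‖_A = sup {|χ x| : x ∈ A ∪ {0}}`, with values in `[0, ∞]`. -/
def dualSup {𝕜 E : Type*} [RCLike 𝕜] [AddCommGroup E] [Module 𝕜 E] [TopologicalSpace E]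
    (χ : WeakDual 𝕜 E) (A : Set E) : ℝ≥0∞ :=
  ⨆ x ∈ A ∪ {0}, ‖χ x‖ₑ

/-- The space `C(X, 𝕜)` endowed with the topology `T` (in place of Mathlib's default, the
compact-open topology). -/
def FunSpace {X 𝕜 : Type*} [TopologicalSpace X] [RCLike 𝕜] (_T : TopologicalSpace C(X, 𝕜)) :
    Type _ :=
  C(X, 𝕜)

namespace FunSpace

variable {X 𝕜 : Type*} [TopologicalSpace X] [RCLike 𝕜] (T : TopologicalSpace C(X, 𝕜))

instance : AddCommGroup (FunSpace T) := inferInstanceAs (AddCommGroup C(X, 𝕜))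

instance : Module 𝕜 (FunSpace T) := inferInstanceAs (Module 𝕜 C(X, 𝕜))

instance : Module ℝ (FunSpace T) := inferInstanceAs (Module ℝ C(X, 𝕜))

instance : IsScalarTower ℝ 𝕜 (FunSpace T) := inferInstanceAs (IsScalarTower ℝ 𝕜 C(X, 𝕜))

instance : FunLike (FunSpace T) X 𝕜 := inferInstanceAs (FunLike C(X, 𝕜) X 𝕜)

instance : TopologicalSpace (FunSpace T) := T

/-- The set `[X; 1]` of all continuous functions `f` with `|f x| ≤ 1` for all `x`. -/
def unitBall : Set (FunSpace T) := {f | ∀ x : X, ‖f x‖ ≤ 1}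

end FunSpace

/-- The topology of pointwise convergence on `C(X, 𝕜)`. -/
abbrev pointwiseTopology (X 𝕜 : Type*) [TopologicalSpace X] [RCLike 𝕜] :
    TopologicalSpace C(X, 𝕜) :=
  TopologicalSpace.induced (fun (f : C(X, 𝕜)) (x : X) => f x) Pi.topologicalSpace

end

/-! The unit ball is barrel-bounded, because barrels pull back to barrels of the Banach space of
bounded continuous functions (`isBarrelBounded_unitBall`). Hence a normalized weak* null sequence is
not `β*`-null. Conversely, let `χ n` be pointwise bounded. A gliding hump argument shows that each
`f` is bounded on the union of the supports (`exists_forall_eq_zero_of_vanish_sublevel`). Truncating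
`f` then gives one `r` with `‖χ n f‖ ≤ r * ‖χ n‖` for all `n`, so the set where `‖χ n f‖ ≤ ‖χ n‖`
for all `n` is absorbent, hence a barrel. A barrel-bounded set lies in some `m`-fold multiple of it,
so norm null sequences that are weak* null are `β*`-null. If `β*`-convergence fails, the norms stay
away from `0` along a subsequence, which can be normalized. -/

/-! ### Gliding hump for functionals on the compact-open space. -/

section CompactOpen

variable {𝕜 X : Type*} [RCLike 𝕜] [TopologicalSpace X]

variable (X 𝕜) in
/-- The dual of `C(X, 𝕜)` with the compact-open topology. -/
abbrev CompactOpenDual : Type _ := C(X, 𝕜) →L[𝕜] 𝕜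

/-- A functional that is continuous for the compact-open topology is bounded on the functions
that are bounded by `1` on some compact set. -/
theorem exists_isCompact_norm_apply_le (χ : CompactOpenDual 𝕜 X) :
    ∃ K : Set X, IsCompact K ∧ ∃ C : ℝ, ∀ f : C(X, 𝕜), (∀ x ∈ K, ‖f x‖ ≤ 1) → ‖χ f‖ ≤ C := by
  have hnhds : χ ⁻¹' Metric.ball 0 1 ∈ 𝓝 (0 : C(X, 𝕜)) :=
    χ.continuous.continuousAt.preimage_mem_nhds (by simpa using Metric.ball_mem_nhds _ one_pos)
  obtain ⟨⟨K, ε⟩, ⟨hK, hε⟩, hsub⟩ := (nhds_basis_uniformity'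
    (Metric.uniformity_basis_dist (α := 𝕜)).compactConvergenceUniformity).mem_iff.1 hnhds
  have hε : 0 < ε := hε
  -- The neighbourhood is given by a strict inequality, so `f` is scaled by `ε / 2` rather than `ε`.
  refine ⟨K, hK, 2 / ε, fun f hf => ?_⟩
  have hmem : ((ε / 2 : ℝ) : 𝕜) • f ∈ χ ⁻¹' Metric.ball 0 1 := by
    refine hsub fun x hx => ?_
    have h1 := hf x hx
    simp only [ContinuousMap.zero_apply, ContinuousMap.smul_apply, Set.mem_ofPred_eq,
      dist_zero_left, norm_smul, RCLike.norm_ofReal, abs_of_pos (half_pos hε)]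
    nlinarith
  simp only [Set.mem_preimage, map_smul, mem_ball_zero_iff, norm_smul, RCLike.norm_ofReal,
    abs_of_pos (half_pos hε)] at hmem
  rw [le_div_iff₀ hε]
  linarith

/-- A functional that is continuous for the compact-open topology annihilates the functions that
vanish on a sufficiently large sublevel set of the norm of a given continuous function. -/
theorem exists_eq_zero_of_vanish_sublevel (χ : CompactOpenDual 𝕜 X) (f : C(X, 𝕜)) :
    ∃ R : ℝ, ∀ g : C(X, 𝕜), (∀ x, ‖f x‖ ≤ R → g x = 0) → χ g = 0 := by
  obtain ⟨K, hK, C, hC⟩ := exists_isCompact_norm_apply_le χ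
  obtain ⟨R, hR⟩ := hK.exists_bound_of_continuousOn f.continuous.continuousOn
  refine ⟨R, fun g hg => ?_⟩
  -- All multiples of `g` vanish on `K`, so their images share the bound `C`.
  by_contra h
  obtain ⟨n, hn⟩ := exists_nat_gt (C / ‖χ g‖)
  have h1 := hC ((n : 𝕜) • g) fun x hx => by simp [hg x (hR x hx)]
  rw [div_lt_iff₀ (norm_pos_iff.2 h)] at hn
  rw [map_smul, norm_smul, RCLike.norm_natCast] at h1
  linarith

/-- Radial truncation of a continuous function. -/
theorem ContinuousMap.exists_truncation (f : C(X, 𝕜)) {r : ℝ} (hr : 0 < r) :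
    ∃ g : C(X, 𝕜), (∀ x, ‖g x‖ ≤ r) ∧ ∀ x, ‖f x‖ ≤ r → g x = f x := by
  have hpos (x : X) : 0 < max r ‖f x‖ := lt_max_of_lt_left hr
  refine ⟨⟨fun x => ((r / max r ‖f x‖ : ℝ) : 𝕜) * f x, ?_⟩, fun x => ?_, fun x hx => ?_⟩
  · refine (RCLike.continuous_ofReal.comp ?_).mul f.continuous
    exact continuous_const.div (by fun_prop) fun x => (hpos x).ne'
  · simp only [ContinuousMap.coe_mk, norm_mul, RCLike.norm_ofReal,
      abs_of_pos (div_pos hr (hpos x))]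
    rw [div_mul_eq_mul_div, div_le_iff₀ (hpos x)]
    exact mul_le_mul_of_nonneg_left (le_max_right _ _) hr.le
  · simp [max_eq_left hx, hr.ne']

/-- A lower triangular system of equations with nonzero diagonal is solvable. -/
theorem exists_sum_range_succ_mul_eq {K : Type*} [Field K] (a : ℕ → ℕ → K)
    (ha : ∀ k, a k k ≠ 0) (b : ℕ → K) :
    ∃ c : ℕ → K, ∀ k, ∑ j ∈ Finset.range (k + 1), c j * a k j = b k := by
  have step (k : ℕ) (p : (j : ℕ) → j < k → K) :
      ∃ z : K, (∑ j : Fin k, p j j.2 * a k j) + z * a k k = b k :=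
    ⟨(b k - ∑ j : Fin k, p j j.2 * a k j) / a k k, by
      rw [div_mul_cancel₀ _ (ha k)]; ring⟩
  choose z hz using step
  let c : ℕ → K := fun k => Nat.strongRec (motive := fun _ => K) z k
  have hc (k : ℕ) : c k = z k fun j _ => c j := by
    simp only [c]
    rw [Nat.strongRec_eq]
  refine ⟨c, fun k => ?_⟩
  rw [Finset.sum_range_succ, Finset.sum_range fun j => c j * a k j, hc k]
  exact hz k fun j _ => c j

/-- For a pointwise bounded sequence of functionals that are continuous for the compact-open
topology, every continuous function is bounded on the union of the supports. -/
theorem exists_forall_eq_zero_of_vanish_sublevel (χ : ℕ → CompactOpenDual 𝕜 X)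
    (hχ : ∀ g : C(X, 𝕜), ∃ M : ℝ, ∀ n, ‖χ n g‖ ≤ M) (f : C(X, 𝕜)) :
    ∃ r : ℝ, 0 < r ∧
      ∀ (n : ℕ) (g : C(X, 𝕜)), (∀ x, ‖f x‖ ≤ r → g x = 0) → χ n g = 0 := by
  by_contra! hcon
  choose R hR using fun n => exists_eq_zero_of_vanish_sublevel (χ n) f
  -- Positivity moves inside the existential so that the choices depend on `r` alone.
  have hcon' (r : ℝ) : ∃ (n : ℕ) (g : C(X, 𝕜)), 0 < r →
      (∀ x, ‖f x‖ ≤ r → g x = 0) ∧ χ n g ≠ 0 := by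
    by_cases hr : 0 < r
    · obtain ⟨n, g, h⟩ := hcon r hr
      exact ⟨n, g, fun _ => h⟩
    · exact ⟨0, 0, fun h => absurd h hr⟩
  choose N G hG using hcon'
  -- The term `s + 1` drives the radii to infinity, for local finiteness; `R (N s)` makes the `k`-th
  -- chosen functional blind to all humps after the `k`-th, so the system is triangular.
  let r : ℕ → ℝ := fun k => Nat.rec 1 (fun _ s => max (s + 1) (R (N s))) k
  have hr1 (k : ℕ) : r k + 1 ≤ r (k + 1) := le_max_left _ _
  have hrR (k : ℕ) : R (N (r k)) ≤ r (k + 1) := le_max_right _ _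
  have hmono : Monotone r := monotone_nat_of_le_succ fun k => by linarith [hr1 k]
  have hrk (k : ℕ) : (k : ℝ) + 1 ≤ r k := by
    induction k with
    | zero => simp [r]
    | succ k ih => push_cast; linarith [hr1 k]
  have hrpos (k : ℕ) : 0 < r k := lt_of_lt_of_le (by positivity) (hrk k)
  -- With right-hand side `k`, the values on the sum of humps are unbounded.
  obtain ⟨c, hc⟩ := exists_sum_range_succ_mul_eq (fun k j => χ (N (r k)) (G (r j)))
    (fun k => (hG _ (hrpos k)).2) (fun k => (k : 𝕜))
  have hvan (j : ℕ) (x : X) (hx : ‖f x‖ ≤ r j) : c j * G (r j) x = 0 := by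
    rw [(hG _ (hrpos j)).1 x hx, mul_zero]
  have hfin : LocallyFinite fun j => Function.support fun x => c j * G (r j) x := by
    intro x
    obtain ⟨m, hm⟩ := exists_nat_gt ‖f x‖
    refine ⟨{y | ‖f y‖ < m}, (isOpen_lt (by fun_prop) continuous_const).mem_nhds hm,
      (Set.finite_lt_nat m).subset ?_⟩
    rintro j ⟨y, hy, hym⟩
    by_contra hj
    refine hy (hvan j y ?_)
    have : (m : ℝ) ≤ j := by exact_mod_cast not_lt.1 hj
    have hym : ‖f y‖ < m := hym
    linarith [hrk j]
  let g : C(X, 𝕜) := ⟨fun x => ∑ᶠ j, c j * G (r j) x,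
    continuous_finsum (fun j => by fun_prop) hfin⟩
  obtain ⟨M, hM⟩ := hχ g
  obtain ⟨k, hk⟩ := exists_nat_gt M
  have hsplit : χ (N (r k)) (g - ∑ j ∈ Finset.range (k + 1), c j • G (r j)) = 0 := by
    refine hR _ _ fun x hx => ?_
    have hsum : g x = ∑ j ∈ Finset.range (k + 1), c j * G (r j) x := by
      refine finsum_eq_sum_of_support_subset _ fun j hj => ?_
      by_contra hjk
      have hkj : k + 1 ≤ j := by simpa using hjk
      exact hj (hvan j x ((hx.trans (hrR k)).trans (hmono hkj)))
    simp [hsum, ContinuousMap.sum_apply]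
  rw [map_sub, sub_eq_zero] at hsplit
  have hval : χ (N (r k)) g = k := by
    rw [hsplit, map_sum, ← hc k]
    simp
  have := hM (N (r k))
  rw [hval, RCLike.norm_natCast] at this
  linarith

/-- For a pointwise bounded sequence of functionals that are continuous for the compact-open
topology, every continuous function may be replaced by a bounded one. -/
theorem exists_bounded_forall_apply_eq (χ : ℕ → CompactOpenDual 𝕜 X)
    (hχ : ∀ g : C(X, 𝕜), ∃ M : ℝ, ∀ n, ‖χ n g‖ ≤ M) (f : C(X, 𝕜)) :
    ∃ r : ℝ, 0 < r ∧ ∃ g : C(X, 𝕜), (∀ x, ‖g x‖ ≤ r) ∧ ∀ n, χ n f = χ n g := by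
  obtain ⟨r, hr, hvan⟩ := exists_forall_eq_zero_of_vanish_sublevel χ hχ f
  obtain ⟨g, hg, hgf⟩ := f.exists_truncation hr
  refine ⟨r, hr, g, hg, fun n => ?_⟩
  have h := hvan n (f - g) fun x hx => by
    rw [ContinuousMap.sub_apply, hgf x hx, sub_self]
  rwa [map_sub, sub_eq_zero] at h

/-- A linear functional that is continuous for the compact-open topology. -/
def CompactOpenDual.ofLinearMap (χ : C(X, 𝕜) →ₗ[𝕜] 𝕜) (h : Continuous χ) :
    CompactOpenDual 𝕜 X :=
  ⟨χ, h⟩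

end CompactOpen

/-! ### The dual norm for coarser topologies. -/

namespace FunSpace

variable {𝕜 X : Type*} [RCLike 𝕜] [TopologicalSpace X] {T : TopologicalSpace C(X, 𝕜)}

/-- A functional that is continuous for a topology coarser than the compact-open topology,
as a functional on `C(X, 𝕜)` with the compact-open topology. -/
noncomputable def toCompactOpenDual (hk : (ContinuousMap.compactOpen : TopologicalSpace C(X, 𝕜)) ≤ T)
    (χ : WeakDual 𝕜 (FunSpace T)) : CompactOpenDual 𝕜 X :=
  have h : Continuous (fun f : FunSpace T => χ f) :=
    ContinuousLinearMap.continuous (WeakDual.toStrongDual χ)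
  CompactOpenDual.ofLinearMap
    { toFun := fun f => χ (show FunSpace T from f)
      map_add' := fun f g => map_add χ (show FunSpace T from f) (show FunSpace T from g)
      map_smul' := fun a f => map_smul χ a (show FunSpace T from f) }
    (continuous_le_dom hk h)

theorem enorm_apply_le_dualSup (χ : WeakDual 𝕜 (FunSpace T)) {f : FunSpace T}
    (hf : f ∈ unitBall T) : ‖χ f‖ₑ ≤ dualSup χ (unitBall T) :=
  le_iSup₂ (f := fun x (_ : x ∈ unitBall T ∪ {0}) => ‖χ x‖ₑ) f (Or.inl hf)

/-- Continuity bounds the functional on functions bounded by `1` on a compact set, and these include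
the unit ball. Hence `toReal` loses no information. -/
theorem dualSup_unitBall_ne_top
    (hk : (ContinuousMap.compactOpen : TopologicalSpace C(X, 𝕜)) ≤ T)
    (χ : WeakDual 𝕜 (FunSpace T)) : dualSup χ (unitBall T) ≠ ⊤ := by
  obtain ⟨K, -, C, hC⟩ := exists_isCompact_norm_apply_le (toCompactOpenDual hk χ)
  refine ne_top_of_le_ne_top (ENNReal.ofReal_ne_top (r := C)) (iSup₂_le fun f hf => ?_)
  have hf1 : ∀ x : X, ‖f x‖ ≤ 1 := by
    rcases hf with hf | rfl
    · exact hf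
    · intro x
      exact (norm_zero (E := 𝕜)).trans_le zero_le_one
  rw [← ofReal_norm]
  exact ENNReal.ofReal_le_ofReal (hC f fun x _ => hf1 x)

theorem norm_apply_le_mul_dualSup
    (hk : (ContinuousMap.compactOpen : TopologicalSpace C(X, 𝕜)) ≤ T)
    (χ : WeakDual 𝕜 (FunSpace T)) {f : FunSpace T} {r : ℝ} (hr : 0 < r)
    (hf : ∀ x : X, ‖f x‖ ≤ r) : ‖χ f‖ ≤ r * (dualSup χ (unitBall T)).toReal := by
  have hmem : ((r⁻¹ : ℝ) : 𝕜) • f ∈ unitBall T := by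
    intro x
    change ‖((r⁻¹ : ℝ) : 𝕜) • f x‖ ≤ 1
    rw [norm_smul, RCLike.norm_ofReal, abs_of_pos (inv_pos.2 hr), inv_mul_le_iff₀ hr, mul_one]
    exact hf x
  have h := ENNReal.toReal_mono (dualSup_unitBall_ne_top hk χ) (enorm_apply_le_dualSup χ hmem)
  rw [toReal_enorm, map_smul, norm_smul, RCLike.norm_ofReal, abs_of_pos (inv_pos.2 hr),
    inv_mul_le_iff₀ hr] at h
  exact h

/-- A pointwise bounded sequence of functionals remains pointwise bounded after division by the
norms. -/
theorem exists_forall_norm_apply_le_mul_dualSup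
    (hk : (ContinuousMap.compactOpen : TopologicalSpace C(X, 𝕜)) ≤ T)
    (χ : ℕ → WeakDual 𝕜 (FunSpace T))
    (hχ : ∀ f : FunSpace T, ∃ M : ℝ, ∀ n, ‖χ n f‖ ≤ M) (f : FunSpace T) :
    ∃ r : ℝ, 0 < r ∧ ∀ n, ‖χ n f‖ ≤ r * (dualSup (χ n) (unitBall T)).toReal := by
  obtain ⟨r, hr, g, hg, hgf⟩ :=
    exists_bounded_forall_apply_eq (fun n => toCompactOpenDual hk (χ n)) hχ f
  exact ⟨r, hr, fun n =>
    (congrArg norm (hgf n)).trans_le (norm_apply_le_mul_dualSup hk (χ n) hr hg)⟩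

end FunSpace

/-! ### Barrels and polars. -/

section Barrel

theorem RCLike.tendsto_natCast_cobounded (𝕜 : Type*) [RCLike 𝕜] :
    Tendsto (Nat.cast : ℕ → 𝕜) atTop (Bornology.cobounded 𝕜) := by
  rw [← tendsto_norm_atTop_iff_cobounded]
  simpa using tendsto_natCast_atTop_atTop (R := ℝ)

/-- The polar of a pointwise bounded family of functionals is a barrel, also when the bounds are
not uniform. -/
theorem isBarrel_setOf_forall_norm_apply_le {𝕜 E ι : Type*} [RCLike 𝕜] [AddCommGroup E]
    [Module 𝕜 E] [Module ℝ E] [IsScalarTower ℝ 𝕜 E] [TopologicalSpace E]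
    (χ : ι → E →L[𝕜] 𝕜) (ρ : ι → ℝ)
    (h : ∀ x, ∃ r : ℝ, ∀ i, ‖χ i x‖ ≤ r * ρ i) (hρ : ∀ i, 0 ≤ ρ i) :
    IsBarrel 𝕜 {x : E | ∀ i, ‖χ i x‖ ≤ ρ i} := by
  refine ⟨?_, fun x => ?_, ?_, ?_⟩
  · simp only [Set.ofPred_forall]
    exact isClosed_iInter fun i => isClosed_le (χ i).continuous.norm continuous_const
  · obtain ⟨r, hr⟩ := h x
    refine absorbs_iff_norm.2 ⟨max r 1, fun c hc => ?_⟩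
    have hc1 : 1 ≤ ‖c‖ := (le_max_right _ _).trans hc
    have hc0 : c ≠ 0 := norm_pos_iff.1 (one_pos.trans_le hc1)
    rw [Set.singleton_subset_iff, Set.mem_smul_set_iff_inv_smul_mem₀ hc0]
    intro i
    rw [map_smul, norm_smul, norm_inv, inv_mul_le_iff₀ (norm_pos_iff.2 hc0)]
    exact (hr i).trans (mul_le_mul_of_nonneg_right ((le_max_left _ _).trans hc) (hρ i))
  · rintro a ha _ ⟨x, hx, rfl⟩ i
    simp only [map_smul, norm_smul]
    exact (mul_le_of_le_one_left (norm_nonneg _) ha).trans (hx i)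
  · simp only [Set.ofPred_forall]
    refine convex_iInter fun i => ?_
    have hconv := (convex_closedBall (0 : 𝕜) (ρ i)).linear_preimage
      ((χ i : E →ₗ[𝕜] 𝕜).restrictScalars ℝ)
    convert hconv using 1
    ext x
    simp

/-- In a Banach space every barrel contains a multiple of the unit ball. -/
theorem exists_closedBall_subset_natCast_smul {𝕜 E : Type*} [RCLike 𝕜] [NormedAddCommGroup E]
    [NormedSpace 𝕜 E] [NormedSpace ℝ E] [IsScalarTower ℝ 𝕜 E] [CompleteSpace E] {U : Set E}
    (hU : IsBarrel 𝕜 U) : ∃ n : ℕ, Metric.closedBall (0 : E) 1 ⊆ (n : 𝕜) • U := by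
  obtain ⟨hclosed, habs, hbal, hconv⟩ := hU
  -- The shift keeps the scalar nonzero, so each multiple is closed and Baire's theorem applies.
  have hcover : ⋃ n : ℕ, ((n + 1 : ℕ) : 𝕜) • U = Set.univ := by
    refine Set.eq_univ_of_forall fun x => ?_
    have h := ((tendsto_add_atTop_iff_nat 1).2 (RCLike.tendsto_natCast_cobounded 𝕜)).eventually
      (habs x).eventually
    obtain ⟨n, hn⟩ := h.exists
    exact Set.mem_iUnion.2 ⟨n, hn rfl⟩
  obtain ⟨n, x, hx⟩ := nonempty_interior_of_iUnion_of_closed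
    (fun n : ℕ => hclosed.smul_of_ne_zero (c := ((n + 1 : ℕ) : 𝕜))
      (by exact_mod_cast n.succ_ne_zero)) hcover
  obtain ⟨ε, hε, hball⟩ := Metric.mem_nhds_iff.1 (mem_interior_iff_mem_nhds.1 hx)
  set V : Set E := ((n + 1 : ℕ) : 𝕜) • U with hV
  have hVbal : Balanced 𝕜 V := hbal.smul _
  have hVconv : Convex ℝ V := by
    have : V = ((n + 1 : ℕ) : ℝ) • U := by
      ext y
      simp only [hV, Set.mem_smul_set, Nat.cast_smul_eq_nsmul]
    exact this ▸ hconv.smul _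
  -- The ball around `x` moves to the origin: `y` is the midpoint of `x + y` and `-(x - y)`.
  have hsmall (y : E) (hy : ‖y‖ < ε) : y ∈ V := by
    have h1 : x + y ∈ V := hball (by simpa using hy)
    have h2 : -(x - y) ∈ V := hVbal.neg_mem_iff.2 (hball (by simpa [sub_eq_add_neg] using hy))
    have h3 := hVconv h1 h2 (by norm_num : (0 : ℝ) ≤ 1 / 2) (by norm_num : (0 : ℝ) ≤ 1 / 2)
      (by norm_num)
    convert h3 using 1
    module
  obtain ⟨m, hm⟩ := exists_nat_gt ε⁻¹
  have hmpos : (0 : ℝ) < m := (inv_pos.2 hε).trans hm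
  have hm0 : (m : 𝕜) ≠ 0 := by
    exact_mod_cast hmpos.ne'
  refine ⟨m * (n + 1), fun y hy => ?_⟩
  rw [Nat.cast_mul, mul_smul, ← hV, Set.mem_smul_set_iff_inv_smul_mem₀ hm0]
  refine hsmall _ ?_
  rw [norm_smul, norm_inv, RCLike.norm_natCast, inv_mul_lt_iff₀ hmpos]
  have hy : ‖y‖ ≤ 1 := by simpa using hy
  have := (inv_lt_iff_one_lt_mul₀ hε).1 hm
  linarith

end Barrel

/-! ### Barrel-boundedness of the unit ball. -/

open scoped BoundedContinuousFunction

theorem BoundedContinuousFunction.continuous_toContinuousMap {X 𝕜 : Type*} [RCLike 𝕜]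
    [TopologicalSpace X] : Continuous fun f : X →ᵇ 𝕜 => f.toContinuousMap := by
  refine continuous_iff_continuousAt.2 fun f => ?_
  refine ContinuousMap.tendsto_iff_forall_isCompact_tendstoUniformlyOn.2 fun K _ => ?_
  have h : Tendsto (fun g : X →ᵇ 𝕜 => g) (𝓝 f) (𝓝 f) := tendsto_id
  exact (BoundedContinuousFunction.tendsto_iff_tendstoUniformly.1 h).tendstoUniformlyOn

namespace FunSpace

variable {𝕜 X : Type*} [RCLike 𝕜] [TopologicalSpace X] {T : TopologicalSpace C(X, 𝕜)}

/-- The inclusion of the bounded continuous functions. -/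
def ofBounded (T : TopologicalSpace C(X, 𝕜)) : (X →ᵇ 𝕜) →ₗ[𝕜] FunSpace T where
  toFun f := f.toContinuousMap
  map_add' _ _ := rfl
  map_smul' _ _ := rfl

theorem continuous_ofBounded
    (hk : (ContinuousMap.compactOpen : TopologicalSpace C(X, 𝕜)) ≤ T) :
    Continuous (ofBounded T) :=
  continuous_le_rng hk BoundedContinuousFunction.continuous_toContinuousMap

/-- Completeness of the bounded functions in the sup norm supplies the barrelledness that `FunSpace
T` itself may lack. -/
theorem isBarrelBounded_unitBall
    (hk : (ContinuousMap.compactOpen : TopologicalSpace C(X, 𝕜)) ≤ T) :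
    IsBarrelBounded 𝕜 (unitBall T) := by
  intro U hU
  let ι := ofBounded T
  have hι : Continuous ι := continuous_ofBounded hk
  have hbarrel : IsBarrel 𝕜 (ι ⁻¹' U) := by
    refine ⟨hU.1.preimage hι, fun f => ?_, fun a ha => ?_, ?_⟩
    · obtain ⟨r, hr⟩ := absorbs_iff_norm.1 (hU.2.1 (ι f))
      refine absorbs_iff_norm.2 ⟨max r 1, fun c hc => ?_⟩
      have hc0 : c ≠ 0 := norm_pos_iff.1 (one_pos.trans_le ((le_max_right _ _).trans hc))
      have h := hr c ((le_max_left _ _).trans hc)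
      rw [Set.singleton_subset_iff, Set.mem_smul_set_iff_inv_smul_mem₀ hc0] at h ⊢
      rwa [Set.mem_preimage, map_smul]
    · rintro _ ⟨f, hf, rfl⟩
      change ι (a • f) ∈ U
      rw [map_smul]
      exact hU.2.2.1 a ha (Set.smul_mem_smul_set hf)
    · exact hU.2.2.2.linear_preimage (ι.restrictScalars ℝ)
  obtain ⟨n, hn⟩ := exists_closedBall_subset_natCast_smul hbarrel
  refine ⟨n, fun f hf => ?_⟩
  let g : X →ᵇ 𝕜 := BoundedContinuousFunction.ofNormedAddCommGroup (fun x => f x)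
    (show C(X, 𝕜) from f).continuous 1 hf
  have hg : g ∈ Metric.closedBall (0 : X →ᵇ 𝕜) 1 := by
    rw [mem_closedBall_zero_iff]
    exact BoundedContinuousFunction.norm_ofNormedAddCommGroup_le _ zero_le_one _
  obtain ⟨u, hu, hug⟩ := hn hg
  refine ⟨ι u, hu, ?_⟩
  have h : ι ((n : 𝕜) • u) = ι g := congrArg ι hug
  rw [map_smul] at h
  exact h

end FunSpace

/-! ### Weak* null sequences: norms and uniform convergence. -/

theorem tendsto_weakToBetaStar_iff {𝕜 E : Type*} [RCLike 𝕜] [AddCommGroup E] [Module 𝕜 E]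
    [Module ℝ E] [TopologicalSpace E] (μ : ℕ → WeakDual 𝕜 E) (ν : WeakDual 𝕜 E) :
    Tendsto (fun n => weakToBetaStar 𝕜 E (μ n)) atTop (𝓝 (weakToBetaStar 𝕜 E ν)) ↔
      ∀ B : Set E, IsBarrelBounded 𝕜 B →
        ∀ ε > 0, ∀ᶠ n in atTop, ∀ x ∈ B, ‖μ n x - ν x‖ < ε := by
  rw [UniformConvergenceCLM.tendsto_iff_tendstoUniformlyOn]
  refine forall₂_congr fun B _ => ?_
  rw [Metric.tendstoUniformlyOn_iff]
  simp only [dist_eq_norm, norm_sub_rev (weakToBetaStar 𝕜 E ν _)]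
  rfl

theorem tendsto_weakDual_iff {𝕜 E α : Type*} [RCLike 𝕜] [AddCommGroup E] [Module 𝕜 E]
    [TopologicalSpace E] {l : Filter α} {μ : α → WeakDual 𝕜 E} {ν : WeakDual 𝕜 E} :
    Tendsto μ l (𝓝 ν) ↔ ∀ x, Tendsto (fun i => μ i x) l (𝓝 (ν x)) :=
  tendsto_iff_forall_eval_tendsto_topDualPairing

theorem dualSup_smul {𝕜 E : Type*} [RCLike 𝕜] [AddCommGroup E] [Module 𝕜 E]
    [TopologicalSpace E] (a : 𝕜) (χ : WeakDual 𝕜 E) (A : Set E) :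
    dualSup (a • χ) A = ‖a‖ₑ * dualSup χ A := by
  simp only [dualSup, ENNReal.mul_iSup]
  refine iSup_congr fun x => iSup_congr fun _ => ?_
  rw [← enorm_mul]
  rfl

namespace FunSpace

variable {𝕜 X : Type*} [RCLike 𝕜] [TopologicalSpace X] {T : TopologicalSpace C(X, 𝕜)}

/-- A weak* null sequence that is not null in norm can be normalized along a subsequence. -/
theorem exists_normalized_of_not_tendsto_zero
    (hk : (ContinuousMap.compactOpen : TopologicalSpace C(X, 𝕜)) ≤ T)
    {χ : ℕ → WeakDual 𝕜 (FunSpace T)} (hχ : Tendsto χ atTop (𝓝 0))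
    (hnorm : ¬ Tendsto (fun n => (dualSup (χ n) (unitBall T)).toReal) atTop (𝓝 0)) :
    ∃ μ : ℕ → WeakDual 𝕜 (FunSpace T), Tendsto μ atTop (𝓝 0) ∧
      ∀ n, dualSup (μ n) (unitBall T) = 1 := by
  set N : ℕ → ℝ := fun n => (dualSup (χ n) (unitBall T)).toReal with hN
  have hfreq : ∃ ε > 0, ∃ᶠ n in atTop, ε ≤ N n := by
    by_contra! h
    refine hnorm (Metric.tendsto_nhds.2 fun ε hε => ?_)
    filter_upwards [h ε hε] with n hn
    rw [Real.dist_0_eq_abs, abs_of_nonneg ENNReal.toReal_nonneg]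
    exact hn
  obtain ⟨ε, hε, hfreq⟩ := hfreq
  -- Along `φ` the inverse norms are at most `ε⁻¹`, so dividing by the norms preserves weak*
  -- nullity.
  obtain ⟨φ, hφ, hφε⟩ := extraction_of_frequently_atTop hfreq
  have hpos (n : ℕ) : 0 < N (φ n) := hε.trans_le (hφε n)
  refine ⟨fun n => (((N (φ n))⁻¹ : ℝ) : 𝕜) • χ (φ n), tendsto_weakDual_iff.2 fun f => ?_,
    fun n => ?_⟩
  · have h0 : Tendsto (fun n => ε⁻¹ * ‖χ (φ n) f‖) atTop (𝓝 0) := by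
      have h := ((tendsto_weakDual_iff.1 hχ f).comp hφ.tendsto_atTop).norm.const_mul ε⁻¹
      have hz : ‖(0 : WeakDual 𝕜 (FunSpace T)) f‖ = 0 := norm_zero (E := 𝕜)
      rwa [hz, mul_zero] at h
    refine squeeze_zero_norm (fun n => ?_) h0
    change ‖(((N (φ n))⁻¹ : ℝ) : 𝕜) • χ (φ n) f‖ ≤ ε⁻¹ * ‖χ (φ n) f‖
    rw [norm_smul, RCLike.norm_ofReal, abs_of_pos (inv_pos.2 (hpos n))]
    exact mul_le_mul_of_nonneg_right (inv_anti₀ hε (hφε n)) (norm_nonneg _)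
  · rw [dualSup_smul, ← ofReal_norm, RCLike.norm_ofReal, abs_of_pos (inv_pos.2 (hpos n)),
      ← ENNReal.ofReal_toReal (dualSup_unitBall_ne_top hk (χ (φ n))),
      ← ENNReal.ofReal_mul (inv_pos.2 (hpos n)).le]
    change ENNReal.ofReal ((N (φ n))⁻¹ * N (φ n)) = 1
    rw [inv_mul_cancel₀ (hpos n).ne', ENNReal.ofReal_one]

/-- A weak* null sequence that is null in norm is uniformly null on barrel-bounded sets. -/
theorem eventually_forall_norm_lt_of_isBarrelBounded
    (hk : (ContinuousMap.compactOpen : TopologicalSpace C(X, 𝕜)) ≤ T)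
    {χ : ℕ → WeakDual 𝕜 (FunSpace T)} (hχ : Tendsto χ atTop (𝓝 0))
    (hnorm : Tendsto (fun n => (dualSup (χ n) (unitBall T)).toReal) atTop (𝓝 0))
    {B : Set (FunSpace T)} (hB : IsBarrelBounded 𝕜 B) {ε : ℝ} (hε : 0 < ε) :
    ∀ᶠ n in atTop, ∀ f ∈ B, ‖χ n f‖ < ε := by
  have hbdd (f : FunSpace T) : ∃ M : ℝ, ∀ n, ‖χ n f‖ ≤ M := by
    obtain ⟨M, hM⟩ := ((tendsto_weakDual_iff.1 hχ f).norm).bddAbove_range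
    exact ⟨M, fun n => hM (Set.mem_range_self n)⟩
  -- The bounds defining this barrel are the norms themselves, which tend to `0`.
  obtain ⟨m, hm⟩ := hB _ (isBarrel_setOf_forall_norm_apply_le
    (fun n => WeakDual.toStrongDual (χ n)) _
    (fun f => (exists_forall_norm_apply_le_mul_dualSup hk χ hbdd f).imp fun _ h => h.2)
    fun _ => ENNReal.toReal_nonneg)
  have h0 := hnorm.const_mul (m : ℝ)
  rw [mul_zero] at h0
  filter_upwards [h0.eventually_lt_const hε] with n hn f hf
  obtain ⟨u, hu, rfl⟩ := hm hf
  refine lt_of_le_of_lt ?_ hn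
  change ‖χ n ((m : 𝕜) • u)‖ ≤ _
  rw [map_smul, norm_smul, RCLike.norm_natCast]
  exact mul_le_mul_of_nonneg_left (hu n) m.cast_nonneg

end FunSpace

/-- In the order on topologies, `T₁ ≤ T₂` means that every `T₂`-open set is `T₁`-open, so `hp` and
`hk` say that `T` contains the pointwise topology and is contained in the compact-open topology. -/
theorem theoremt {𝕜 : Type*} [RCLike 𝕜] {X : Type*} [TopologicalSpace X] [T35Space X]
    (T : TopologicalSpace C(X, 𝕜))
    [IsTopologicalAddGroup (FunSpace T)] [ContinuousSMul 𝕜 (FunSpace T)]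
    [LocallyConvexSpace ℝ (FunSpace T)]
    (hp : T ≤ pointwiseTopology X 𝕜)
    (hk : (ContinuousMap.compactOpen : TopologicalSpace C(X, 𝕜)) ≤ T) :
    HasJNP 𝕜 (FunSpace T) ↔
      ∃ μ : ℕ → WeakDual 𝕜 (FunSpace T),
        Tendsto μ atTop (𝓝 0) ∧
          ∀ n : ℕ, dualSup (μ n) (FunSpace.unitBall T) = 1 := by
  constructor
  · intro hJ
    by_contra hno
    refine hJ fun μ ν hμ => (tendsto_weakToBetaStar_iff μ ν).2 fun B hB ε hε => ?_
    have hχ : Tendsto (fun n => μ n - ν) atTop (𝓝 0) := by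
      refine tendsto_weakDual_iff.2 fun f => ?_
      have h := (tendsto_weakDual_iff.1 hμ f).sub_const (ν f)
      rw [sub_self] at h
      exact h
    have hnorm : Tendsto (fun n => (dualSup (μ n - ν) (FunSpace.unitBall T)).toReal) atTop
        (𝓝 0) := by
      by_contra h
      exact hno (FunSpace.exists_normalized_of_not_tendsto_zero hk hχ h)
    exact FunSpace.eventually_forall_norm_lt_of_isBarrelBounded hk hχ hnorm hB hε
  · rintro ⟨μ, hμ, hone⟩ hseq
    -- Any constant below `1` contradicts the normalization.
    have h := (tendsto_weakToBetaStar_iff μ 0).1 (hseq hμ) _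
      (FunSpace.isBarrelBounded_unitBall hk) (1 / 2) (by norm_num)
    obtain ⟨n, hn⟩ := h.exists
    have hle : dualSup (μ n) (FunSpace.unitBall T) ≤ ENNReal.ofReal (1 / 2) := by
      refine iSup₂_le fun f hf => ?_
      rw [← ofReal_norm]
      refine ENNReal.ofReal_le_ofReal ?_
      rcases hf with hf | rfl
      · have hlt := hn f hf
        have hz : (0 : WeakDual 𝕜 (FunSpace T)) f = 0 := rfl
        rw [hz, sub_zero] at hlt
        exact hlt.le
      · rw [map_zero, norm_zero]
        norm_num
    rw [hone n, ENNReal.one_le_ofReal] at hle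
    norm_num at hle
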